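/- Let $(M,\omega)$ be $\mathbb R^2$ or a closed surface of genus $g\ge 1$ with a symplectic form, and let $\varphi:M\to M$ be a symplectomorphism with a hyperbolic fixed point $x$, whose stable and unstable manifolds $W^s=\{p\mid \varphi^n(p)\to x,\ n\to\infty\}$ and $W^u=\{p\mid \varphi^{n}(p)\to x,\ n\to-\infty\}$ intersect transversely and strongly (every component of $W^u\setminus\{x\}$ meets every component of $W^s\setminus\{x\}$, in the immersed topologies). Assume that $\varphi$ preserves the orientations of $W^s$ and $W^u$, and fix an orientation $o_u$ of $W^u$. Write $[p,q]_i$ for the segment between $p$ and $q$ in $W^i$. Let $\mathcal H_{[x]}$ be the set of contractible homoclinic points, i.e. of those $p\in W^s\cap W^u$ for which the loop running through $[x,p]_u$ to $p$ and through $[p,x]_s$ back to $x$ is contractible in $M$. Grade it by the Maslov index $\mu(p)=\mu(p,x)$, $\mu(x)=0$; here $\mu(p,q)$ is twice the winding number of the tangent, measured in a trivialization of $TM$ over a disc filling the loop, along the loop through $[p,q]_u$ to $q$ and through $[p,q]_s$ back to $p$, where the tangent line is flipped counterclockwise from $T_qW^u$ to $T_qW^s$ at $q$ and clockwise from $T_pW^s$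 to $T_pW^u$ at $p$ (by $\pm 90^\circ$ if the intersections are perpendicular). For $p,q\in\mathcal H_{[x]}$ with $\mu(p)-\mu(q)=1$ let $n(p,q)=0$ if there is no smooth orientation preserving immersion of a di-gon (a planar disc with two convex corners $\mp1$, lower boundary arc $B_u$ and upper boundary arc $B_s$) into $M$ that maps $-1\mapsto p$, $1\mapsto q$, $B_u$ into $W^u$ and $B_s$ into $W^s$; otherwise let $n(p,q)=1$ if the direction of $[p,q]_u$ from $p$ to $q$ agrees with $o_u$, and $n(p,q)=-1$ if not. For a finite set $E\subset\mathcal H_{[x]}$ let $\mathbb ZE$ be the free abelian group on $E$, graded by $\mathbb ZE=\bigoplus_k\mathbb ZE_k$ with $E_k=\{p\in E\mid\mu(p)=k\}$, and define the linear map $\partial^E:\mathbb ZE\to\mathbb ZE$ by $$\partial^E p=\sum_{q\in E,\ \mu(q)=\mu(p)-1} n(p,q)\,q .$$ Let $\partial^E_k:\mathbb ZE_k\to\mathbb ZE_{k-1}$ be its restriction. Call $E$ $\partial$-complete if $\partial^E\circ\partial^E=0$; in that case put $H_k(E)=\ker\partial^E_k/\operatorname{im}\partial^E_{k+1}$ and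 $H(E)=\bigoplus_{k\in\mathbb Z}H_k(E)$. For $\partial$-complete $D\subseteq E$ let $\mathcal I^{DE}:\mathbb ZD\to\mathbb ZE$ be the inclusion, and call $(D,E)$ chain compatible if $\mathcal I^{DE}\circ\partial^D=\partial^E\circ\mathcal I^{DE}$. Proposition. 1. If $D\subseteq E$ are $\partial$-complete and $(D,E)$ is chain compatible, then the chain map $\mathcal I^{DE}$ induces a map $H(\mathcal I^{DE}):H(D)\to H(E)$: in every degree it sends cycles to cycles, and $H(\mathcal I^{DE})$ is the unique linear map with $[z]\mapsto[\mathcal I^{DE}z]$ for all $k$ and all $z\in\ker\partial^D_k$. 2. If $D\subseteq E\subseteq F$ are $\partial$-complete and $(D,E)$, $(E,F)$, $(D,F)$ are chain compatible, then $H(\mathcal I^{EF})\circ H(\mathcal I^{DE})=H(\mathcal I^{DF})$. 3. If $D$ is $\partial$-complete, then $(D,D)$ is chain compatible and $H(\mathcal I^{DD})=\mathrm{id}_{H(D)}$. -/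

import Mathlib

open scoped Manifold ContDiff DirectSum

noncomputable section

namespace Homoclinic

/-- The Euclidean plane, the model space of all surfaces below. -/
abbrev Plane : Type := EuclideanSpace ℝ (Fin 2)

section Surface

variable {M : Type*} [TopologicalSpace M] [ChartedSpace Plane M]

/-- `H₁(M; ℤ)`, as the abelianization of the fundamental group at `x`. -/
abbrev FirstHomology (M : Type*) [TopologicalSpace M] (x : M) : Type _ :=
  Additive (Abelianization (FundamentalGroup M x))

/-- A closed connected surface (orientable in all uses below, since it carries an area form)
of genus `g`, i.e. with first Betti number `2g`. -/
def IsClosedSurfaceOfGenus (M : Type*) [TopologicalSpace M] (g : ℕ) : Prop :=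
  T2Space M ∧ CompactSpace M ∧ ConnectedSpace M ∧
    ∀ x : M, Module.finrank ℤ (FirstHomology M x) = 2 * g

/-- `M` is the plane, or a closed surface of genus at least one. -/
def IsPlaneOrClosedSurface (M : Type*) [TopologicalSpace M] [ChartedSpace Plane M] : Prop :=
  Nonempty (M ≃ₘ^∞⟮𝓘(ℝ, Plane), 𝓘(ℝ, Plane)⟯ Plane) ∨
    ∃ g : ℕ, 1 ≤ g ∧ IsClosedSurfaceOfGenus M g

/-! ### Invariant manifolds, arcs, orientations -/

/-- The stable manifold `{p | fⁿ(p) → x as n → ∞}`.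
The unstable manifold of `f` is the stable manifold of `f⁻¹`. -/
def stableManifold (f : M → M) (x : M) : Set M :=
  {p | Filter.Tendsto (fun n : ℕ => f^[n] p) Filter.atTop (nhds x)}

/-- The derivative of `f` at a fixed point `x`, as a linear endomorphism of `T_xM`
(which Mathlib identifies with the model space through the preferred chart at `x = f x`). -/
def derivAtFixedPoint (f : M → M) (x : M) : Plane →L[ℝ] Plane :=
  mfderiv 𝓘(ℝ, Plane) 𝓘(ℝ, Plane) f x

/-- `x` is a fixed point of `f`, and no complex eigenvalue of `df(x) : T_xM → T_xM` has
modulus one. -/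
def IsHyperbolicFixedPoint (f : M → M) (x : M) : Prop :=
  f x = x ∧ ∀ z : ℂ,
    ((LinearMap.charpoly (derivAtFixedPoint f x).toLinearMap).map (algebraMap ℝ ℂ)).IsRoot z →
      ‖z‖ ≠ 1

/-- The velocity vector of the curve `c` at time `t`. -/
def velocity (c : ℝ → M) (t : ℝ) : TangentSpace 𝓘(ℝ, Plane) (c t) :=
  mfderiv 𝓘(ℝ, ℝ) 𝓘(ℝ, Plane) c t (1 : ℝ)

/-- `c` restricted to `[0,1]` is an injective smooth immersed curve contained in `W`.
If `W` is an (injectively immersed, one dimensional) stable or unstable manifold, then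
`c([0,1])` is the segment `[c(0), c(1)]` of `W`. -/
structure IsArc (W : Set M) (c : ℝ → M) : Prop where
  smooth : ContMDiff 𝓘(ℝ, ℝ) 𝓘(ℝ, Plane) ∞ c
  injOn : Set.InjOn c (Set.Icc 0 1)
  mapsTo : Set.MapsTo c (Set.Icc 0 1) W
  immersed : ∀ t ∈ Set.Icc (0 : ℝ) 1, velocity c t ≠ 0

/-- The vectors in `T_pM` that are tangent to `W` at `p`, i.e. velocities of arcs in `W`. -/
def tangentVectors (W : Set M) (p : M) : Set (TangentSpace 𝓘(ℝ, Plane) p) :=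
  {v | ∃ c : ℝ → M, IsArc W c ∧ ∃ t ∈ Set.Icc (0 : ℝ) 1,
    (⟨c t, velocity c t⟩ : TangentBundle 𝓘(ℝ, Plane) M) = ⟨p, v⟩}

/-- The arc `c` runs in the direction of `o`. -/
def RunsAlong (o : ∀ p : M, TangentSpace 𝓘(ℝ, Plane) p) (c : ℝ → M) : Prop :=
  ∀ t ∈ Set.Icc (0 : ℝ) 1, ∃ r : ℝ, 0 < r ∧ velocity c t = r • o (c t)

/-- The arc `c` runs opposite to the direction of `o`. -/
def RunsAgainst (o : ∀ p : M, TangentSpace 𝓘(ℝ, Plane) p) (c : ℝ → M) : Prop :=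
  ∀ t ∈ Set.Icc (0 : ℝ) 1, ∃ r : ℝ, r < 0 ∧ velocity c t = r • o (c t)

/-- `o` is an orientation of the immersed curve `W`: it picks for each point of `W` a tangent
direction of `W`, consistently along arcs in `W`. (The values of `o` off `W` are irrelevant.) -/
def IsOrientation (W : Set M) (o : ∀ p : M, TangentSpace 𝓘(ℝ, Plane) p) : Prop :=
  ∀ c : ℝ → M, IsArc W c → RunsAlong o c ∨ RunsAgainst o c

/-- The diffeomorphism `f` of `M` preserves the orientations of the invariant curve `W`. -/
def PreservesOrientation (f : M → M) (W : Set M) : Prop :=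
  ∀ o : ∀ p : M, TangentSpace 𝓘(ℝ, Plane) p, IsOrientation W o →
    ∀ p ∈ W, ∃ r : ℝ, 0 < r ∧
      mfderiv 𝓘(ℝ, Plane) 𝓘(ℝ, Plane) f p (o p) = r • o (f p)

/-- The two curves `Wu`, `Ws` through `x` intersect transversely. -/
def IntersectTransversely (Wu Ws : Set M) : Prop :=
  ∀ p ∈ Wu ∩ Ws, ∀ v ∈ tangentVectors Wu p, ∀ w ∈ tangentVectors Ws p,
    LinearIndependent ℝ ![v, w]

/-- Each branch of `Wu` intersects each branch of `Ws`. The branches of `W` are the path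
components of `W \ {x}`, here given by points `a`, `b` on them (connected components for the
immersed topology of `W`, which need not be such for the topology induced by `M`). -/
def IntersectStrongly (Wu Ws : Set M) (x : M) : Prop :=
  ∀ a ∈ Wu \ {x}, ∀ b ∈ Ws \ {x}, ∃ p, JoinedIn (Wu \ {x}) a p ∧ JoinedIn (Ws \ {x}) b p

end Surface

/-! ### The geometric data -/

/-- A `W`-orientation preserving symplectomorphism `φ` of the plane or of a closed surface of
genus at least one, together with a hyperbolic fixed point `x` whose stable and unstable manifold
intersect strongly and transversely, and an orientation `oᵤ` of the unstable manifold. -/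
structure Tangle (M : Type*) [TopologicalSpace M] [ChartedSpace Plane M]
    [IsManifold 𝓘(ℝ, Plane) ∞ M] where
  isSurface : IsPlaneOrClosedSurface M
  /-- The symplectic form `ω`. In dimension two every smooth two-form is closed. -/
  form (p : M) : TangentSpace 𝓘(ℝ, Plane) p →L[ℝ] TangentSpace 𝓘(ℝ, Plane) p →L[ℝ] ℝ
  form_smooth : ContMDiff 𝓘(ℝ, Plane)
    (𝓘(ℝ, Plane).prod 𝓘(ℝ, Plane →L[ℝ] Plane →L[ℝ] ℝ)) ∞
    (fun p ↦ Bundle.TotalSpace.mk' (Plane →L[ℝ] Plane →L[ℝ] ℝ)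
      (E := fun p : M ↦ TangentSpace 𝓘(ℝ, Plane) p →L[ℝ] TangentSpace 𝓘(ℝ, Plane) p →L[ℝ] ℝ)
      p (form p))
  form_alternating : ∀ p v, form p v v = 0
  form_nondegenerate : ∀ p v, (∀ w, form p v w = 0) → v = 0
  /-- The symplectomorphism. -/
  φ : M ≃ₘ^∞⟮𝓘(ℝ, Plane), 𝓘(ℝ, Plane)⟯ M
  φ_symplectic : ∀ p v w,
    form (φ p) (mfderiv 𝓘(ℝ, Plane) 𝓘(ℝ, Plane) φ p v) (mfderiv 𝓘(ℝ, Plane) 𝓘(ℝ, Plane) φ p w) =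
      form p v w
  /-- The fixed point. -/
  x : M
  hyperbolic : IsHyperbolicFixedPoint φ x
  transverse : IntersectTransversely (stableManifold φ.symm x) (stableManifold φ x)
  strong : IntersectStrongly (stableManifold φ.symm x) (stableManifold φ x) x
  preservesOrientation_u : PreservesOrientation φ (stableManifold φ.symm x)
  preservesOrientation_s : PreservesOrientation φ (stableManifold φ x)
  /-- The orientation `oᵤ` of the unstable manifold. -/
  o (p : M) : TangentSpace 𝓘(ℝ, Plane) p
  o_orientation : IsOrientation (stableManifold φ.symm x) o

namespace Tangle

variable {M : Type*} [TopologicalSpace M] [ChartedSpace Plane M] [IsManifold 𝓘(ℝ, Plane) ∞ M]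
variable (S : Tangle M)

/-- The stable manifold of `x`. -/
def Ws : Set M := stableManifold S.φ S.x

/-- The unstable manifold of `x`. -/
def Wu : Set M := stableManifold S.φ.symm S.x

/-- The set of contractible homoclinic points: the loop running from `x` in `Wᵘ` to `p`
and back in `Wˢ` to `x` is contractible. (As `Wᵘ` and `Wˢ` are immersed lines, its homotopy class
depends on `p` only.) -/
def contractible : Set M :=
  {p | p ∈ S.Ws ∩ S.Wu ∧ ∃ (a : Path S.x p) (b : Path p S.x),
    Set.range a ⊆ S.Wu ∧ Set.range b ⊆ S.Ws ∧ (a.trans b).Homotopic (Path.refl S.x)}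

/-! ### The Maslov index -/

/-- `m` is the relative Maslov index of two distinct homoclinic points `p`, `q` with the same
homotopy class. The curves `h(·,0)` and `h(·,1)` run from `p` to `q` along `[p,q]ᵤ` and `[p,q]ₛ`,
and `h` is a homotopy (disc) between them. `X, Y` is a positively oriented frame of `TM` over that
disc, and `θᵤ`, `θₛ` are the angles of the tangents of the two curves with respect to the frame.
The tangent of the loop that runs through `[p,q]ᵤ` to `q` and through `[p,q]ₛ` back to `p` turns by
`θᵤ(1) - θᵤ(0)` along `[p,q]ᵤ`, then by an angle `δ_q ∈ (0,π)` that flips the line `T_qWᵘ`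
counterclockwise to `T_qWˢ` at `q`, then by `θₛ(0) - θₛ(1)` along `[p,q]ₛ`, then by an angle
`-δ_p ∈ (-π,0)` that flips the line `T_pWˢ` clockwise to `T_pWᵘ` at `p` (`δ_q = δ_p = π/2` when the
intersections are perpendicular). The index is twice the winding number, i.e. the total rotation
divided by `π`. -/
def IsMaslovIndex (p q : M) (m : ℤ) : Prop :=
  ∃ (h : ℝ → ℝ → M) (X Y : ∀ t s : ℝ, TangentSpace 𝓘(ℝ, Plane) (h t s))
    (θu θs : ℝ → ℝ) (δq δp : ℝ),
    IsArc S.Wu (fun t => h t 0) ∧ IsArc S.Ws (fun t => h t 1) ∧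
    (∀ s ∈ Set.Icc (0 : ℝ) 1, h 0 s = p ∧ h 1 s = q) ∧
    ContinuousOn (fun z : ℝ × ℝ => h z.1 z.2) (Set.Icc 0 1 ×ˢ Set.Icc 0 1) ∧
    -- the frame, constant along the two edges of the square that are collapsed to `p` and `q`
    ContinuousOn (fun z : ℝ × ℝ => (⟨h z.1 z.2, X z.1 z.2⟩ : TangentBundle 𝓘(ℝ, Plane) M))
      (Set.Icc 0 1 ×ˢ Set.Icc 0 1) ∧
    ContinuousOn (fun z : ℝ × ℝ => (⟨h z.1 z.2, Y z.1 z.2⟩ : TangentBundle 𝓘(ℝ, Plane) M))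
      (Set.Icc 0 1 ×ˢ Set.Icc 0 1) ∧
    (∀ t ∈ Set.Icc (0 : ℝ) 1, ∀ s ∈ Set.Icc (0 : ℝ) 1, 0 < S.form (h t s) (X t s) (Y t s)) ∧
    (∀ t ∈ ({0, 1} : Set ℝ), ∀ s ∈ Set.Icc (0 : ℝ) 1,
      (⟨h t s, X t s⟩ : TangentBundle 𝓘(ℝ, Plane) M) = ⟨h t 0, X t 0⟩ ∧
      (⟨h t s, Y t s⟩ : TangentBundle 𝓘(ℝ, Plane) M) = ⟨h t 0, Y t 0⟩) ∧
    -- the angles of the tangents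
    ContinuousOn θu (Set.Icc 0 1) ∧ ContinuousOn θs (Set.Icc 0 1) ∧
    (∀ t ∈ Set.Icc (0 : ℝ) 1, ∃ r : ℝ, 0 < r ∧
      velocity (fun t => h t 0) t
        = r • (Real.cos (θu t) • X t 0 + Real.sin (θu t) • Y t 0)) ∧
    (∀ t ∈ Set.Icc (0 : ℝ) 1, ∃ r : ℝ, 0 < r ∧
      velocity (fun t => h t 1) t
        = r • (Real.cos (θs t) • X t 1 + Real.sin (θs t) • Y t 1)) ∧
    -- the flips at the vertices
    δq ∈ Set.Ioo 0 Real.pi ∧ (∃ j : ℤ, θu 1 + δq = θs 1 + j * Real.pi) ∧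
    δp ∈ Set.Ioo 0 Real.pi ∧ (∃ j : ℤ, θs 0 - δp = θu 0 + j * Real.pi) ∧
    -- the total rotation
    (θu 1 - θu 0) + δq + (θs 0 - θs 1) - δp = m * Real.pi

open Classical in
/-- The relative Maslov index `μ(p,q)` of homoclinic points in the same homotopy class, with the
convention `μ(p,p) = 0`. -/
def relativeMaslov (p q : M) : ℤ :=
  if p = q then 0 else if h : ∃ m, S.IsMaslovIndex p q m then h.choose else 0

/-- The grading `μ(p) = μ(p,x)` of contractible homoclinic points. -/
def μ (p : M) : ℤ := S.relativeMaslov p S.x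

/-! ### Immersed di-gons and signs -/

/-- The standard di-gon in the plane, with convex vertices at `(-1,0)` and `(1,0)`. -/
def digon : Set Plane := {z | |z 1| ≤ 1 - z 0 ^ 2}

/-- The upper boundary arc of the di-gon. -/
def digonUpper : Set Plane := {z | |z 0| ≤ 1 ∧ z 1 = 1 - z 0 ^ 2}

/-- The lower boundary arc of the di-gon. -/
def digonLower : Set Plane := {z | |z 0| ≤ 1 ∧ z 1 = -(1 - z 0 ^ 2)}

/-- The space `𝓜(p,q)` of smooth orientation preserving immersed di-gons from `p` to `q`
(immersions also on the boundary and at the vertices). -/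
def immersedDigons (p q : M) : Set (Plane → M) :=
  {v | ContMDiffOn 𝓘(ℝ, Plane) 𝓘(ℝ, Plane) ∞ v digon ∧
    (∀ z ∈ digon, 0 < S.form (v z)
      (mfderivWithin 𝓘(ℝ, Plane) 𝓘(ℝ, Plane) v digon z (!₂[1, 0] : Plane))
      (mfderivWithin 𝓘(ℝ, Plane) 𝓘(ℝ, Plane) v digon z (!₂[0, 1] : Plane))) ∧
    Set.MapsTo v digonLower S.Wu ∧ Set.MapsTo v digonUpper S.Ws ∧
    v !₂[-1, 0] = p ∧ v !₂[1, 0] = q}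

open Classical in
/-- The sign `n(p,q)`: zero if there is no immersed di-gon from `p` to `q` (equivalently no
unparametrized one), and otherwise `1` or `-1` according to whether the direction of the segment
`[p,q]ᵤ` from `p` to `q` agrees with the orientation `oᵤ` or not. -/
def n (p q : M) : ℤ :=
  if (S.immersedDigons p q).Nonempty then
    if ∃ c : ℝ → M, IsArc S.Wu c ∧ c 0 = p ∧ c 1 = q ∧ RunsAlong S.o c then 1 else -1
  else 0

/-! ### Chain groups, boundary operator, homology -/

/-- `𝓔`: the finite sets of contractible homoclinic points. -/
def finiteSets : Set (Finset M) := {E | (E : Set M) ⊆ S.contractible}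

/-- `ℤE`, the free abelian group generated by `E`. -/
abbrev FreeAb (E : Finset M) : Type _ := E →₀ ℤ

/-- `∂ᴱ : ℤE → ℤE`, the linear map with `∂ᴱ p = ∑ n(p,q) q`, where the sum is
over all `q ∈ E` with `μ(q) = μ(p) - 1`. -/
def boundary (E : Finset M) : FreeAb E →ₗ[ℤ] FreeAb E :=
  Finsupp.linearCombination ℤ fun p : E =>
    ∑ q ∈ (Finset.univ : Finset E).filter (fun q : E => S.μ q = S.μ p - 1),
      Finsupp.single q (S.n p q)

/-- The set of `∂`-complete finite sets of contractible homoclinic points. -/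
def completeSets : Set (Finset M) := {E | E ∈ S.finiteSets ∧ S.boundary E ∘ₗ S.boundary E = 0}

/-- `C_k(E) = ℤE_k ⊆ ℤE`, generated by the `p ∈ E` with `μ(p) = k`. -/
def chains (E : Finset M) (k : ℤ) : Submodule ℤ (FreeAb E) :=
  Finsupp.supported ℤ ℤ {p : E | S.μ p = k}

/-- The kernel of `∂ᴱ_k : C_k(E) → C_{k-1}(E)`. -/
def cycles (E : Finset M) (k : ℤ) : Submodule ℤ (FreeAb E) :=
  S.chains E k ⊓ LinearMap.ker (S.boundary E)

/-- The image of `∂ᴱ_{k+1} : C_{k+1}(E) → C_k(E)`. -/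
def boundaries (E : Finset M) (k : ℤ) : Submodule ℤ (FreeAb E) :=
  (S.chains E (k + 1)).map (S.boundary E)

/-- `H_k(E) = ker ∂ᴱ_k / im ∂ᴱ_{k+1}`. -/
abbrev HomologyGroup (E : Finset M) (k : ℤ) : Type _ :=
  S.cycles E k ⧸ (S.boundaries E k).submoduleOf (S.cycles E k)

/-- `H(E) = ⨁_k H_k(E)`. -/
abbrev Homology (E : Finset M) : Type _ := ⨁ k : ℤ, S.HomologyGroup E k

/-- The class in `H(E)` of a cycle of degree `k`. -/
def homologyClass (E : Finset M) (k : ℤ) (z : S.cycles E k) : S.Homology E :=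
  DirectSum.lof ℤ ℤ (S.HomologyGroup E) k (Submodule.Quotient.mk z)

/-- The inclusion `𝓘ᴰᴱ : ℤD → ℤE`. -/
def incl {D E : Finset M} (hDE : D ⊆ E) : FreeAb D →ₗ[ℤ] FreeAb E :=
  Finsupp.lmapDomain ℤ ℤ fun p : D => (⟨p, hDE p.2⟩ : E)

/-- `(D, E)` is chain compatible: the inclusion is a chain map. -/
def ChainCompatible {D E : Finset M} (hDE : D ⊆ E) : Prop :=
  incl hDE ∘ₗ S.boundary D = S.boundary E ∘ₗ incl hDE

section Induced

variable {S} {D E : Finset M} {hDE : D ⊆ E}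

theorem incl_mem_chains (hDE : D ⊆ E) {k : ℤ} {z : FreeAb D} (hz : z ∈ S.chains D k) :
    incl hDE z ∈ S.chains E k := by
  classical
  intro p hp
  obtain ⟨q, hq, rfl⟩ := Finset.mem_image.1 (Finsupp.mapDomain_support hp)
  exact hz hq

theorem ChainCompatible.incl_mem_cycles (hc : S.ChainCompatible hDE) {k : ℤ} {z : FreeAb D}
    (hz : z ∈ S.cycles D k) : incl hDE z ∈ S.cycles E k := by
  refine ⟨incl_mem_chains hDE hz.1, ?_⟩
  have h := LinearMap.congr_fun hc z
  have h0 : S.boundary D z = 0 := hz.2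
  simpa [h0] using h.symm

theorem ChainCompatible.incl_mem_boundaries (hc : S.ChainCompatible hDE) {k : ℤ} {z : FreeAb D}
    (hz : z ∈ S.boundaries D k) : incl hDE z ∈ S.boundaries E k := by
  obtain ⟨y, hy, rfl⟩ := hz
  exact ⟨incl hDE y, incl_mem_chains hDE hy, (LinearMap.congr_fun hc y).symm⟩

/-- `H_k(𝓘ᴰᴱ) : H_k(D) → H_k(E)`, induced by `𝓘ᴰᴱ` on cycles. -/
def homologyGroupMap (hc : S.ChainCompatible hDE) (k : ℤ) :
    S.HomologyGroup D k →ₗ[ℤ] S.HomologyGroup E k :=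
  Submodule.mapQ _ _ ((incl hDE).restrict fun _ hz => hc.incl_mem_cycles hz)
    fun _ hz => hc.incl_mem_boundaries hz

/-- `H(𝓘ᴰᴱ) = ⨁_k H_k(𝓘ᴰᴱ) : H(D) → H(E)`. -/
def homologyMap (hc : S.ChainCompatible hDE) : S.Homology D →ₗ[ℤ] S.Homology E :=
  DirectSum.lmap (homologyGroupMap hc)

end Induced

/-- The linear map `T : H(D) → H(E)` is induced by `𝓘ᴰᴱ`: in each degree, `𝓘ᴰᴱ` maps cycles to
cycles, and `T [z] = [𝓘ᴰᴱ z]`. -/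
def IsInducedByIncl {D E : Finset M} (hDE : D ⊆ E) (T : S.Homology D →ₗ[ℤ] S.Homology E) : Prop :=
  ∀ (k : ℤ) (z : S.cycles D k), ∃ hz : incl hDE z.1 ∈ S.cycles E k,
    T (S.homologyClass D k z) = S.homologyClass E k ⟨incl hDE z.1, hz⟩

end Tangle

end Homoclinic

end

namespace Homoclinic.Tangle

/-! A linear map out of `S.Homology D` is determined by its values on classes of cycles, because
each summand is a quotient of the cycles and the summands span the direct sum. Hence at most one map
satisfies `[z] ↦ [incl z]` (`IsInducedByIncl.unique`), and `homologyMap` does so by construction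
(`isInducedByIncl_homologyMap`). Functoriality then needs no computation with quotients: the
property `IsInducedByIncl` is stable under composition (`IsInducedByIncl.comp`) and holds for the
identity (`isInducedByIncl_id`), since inclusions of chain groups compose to inclusions. Uniqueness
turns both facts into equalities of maps. -/

theorem incl_incl {M : Type*} {D E F : Finset M} (hDE : D ⊆ E) (hEF : E ⊆ F) (z : FreeAb D) :
    incl hEF (incl hDE z) = incl (hDE.trans hEF) z :=
  (Finsupp.mapDomain_comp (f := fun p : D => (⟨p, hDE p.2⟩ : E))
    (g := fun p : E => (⟨p, hEF p.2⟩ : F))).symm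

theorem incl_refl {M : Type*} (D : Finset M) : incl (Finset.Subset.refl D) = LinearMap.id :=
  Finsupp.lmapDomain_id ℤ ℤ

variable {M : Type*} [TopologicalSpace M] [ChartedSpace Plane M] [IsManifold 𝓘(ℝ, Plane) ∞ M]
variable {S : Tangle M} {D E F : Finset M} {hDE : D ⊆ E} {hEF : E ⊆ F}

theorem homologyMap_homologyClass (hc : S.ChainCompatible hDE) (k : ℤ) (z : S.cycles D k) :
    homologyMap hc (S.homologyClass D k z) =
      S.homologyClass E k ⟨incl hDE z.1, hc.incl_mem_cycles z.2⟩ := by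
  unfold homologyMap homologyClass
  rw [DirectSum.lmap_lof]
  -- What is left concerns a single degree, where `Submodule.mapQ` evaluates on a representative by
  -- definition.
  rfl

/-- The classes of cycles generate the homology. -/
theorem homology_hom_ext {A : Type*} [AddCommMonoid A] [Module ℤ A] {T T' : S.Homology D →ₗ[ℤ] A}
    (h : ∀ k z, T (S.homologyClass D k z) = T' (S.homologyClass D k z)) : T = T' := by
  -- Reduce to one summand, then lift an element of the quotient to a cycle.
  refine DirectSum.linearMap_ext ℤ fun k => LinearMap.ext fun a => ?_
  obtain ⟨z, rfl⟩ := Submodule.Quotient.mk_surjective _ a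
  exact h k z

theorem isInducedByIncl_homologyMap (hc : S.ChainCompatible hDE) :
    S.IsInducedByIncl hDE (homologyMap hc) := fun k z =>
  ⟨hc.incl_mem_cycles z.2, homologyMap_homologyClass hc k z⟩

/-- Both maps send `[z]` to the class of the same chain. The two existential witnesses that it is a
cycle may differ, but proof irrelevance identifies the resulting classes. -/
theorem IsInducedByIncl.unique {T T' : S.Homology D →ₗ[ℤ] S.Homology E}
    (h : S.IsInducedByIncl hDE T) (h' : S.IsInducedByIncl hDE T') : T = T' :=
  homology_hom_ext fun k z => (h k z).choose_spec.trans (h' k z).choose_spec.symm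

theorem chainCompatible_refl (S : Tangle M) (D : Finset M) :
    S.ChainCompatible (Finset.Subset.refl D) := by
  rw [ChainCompatible, incl_refl, LinearMap.id_comp, LinearMap.comp_id]

/-- The predicate itself records that images of cycles are cycles, so the two hypotheses can be
chained without returning to the boundary operators. -/
theorem IsInducedByIncl.comp {T : S.Homology D →ₗ[ℤ] S.Homology E}
    {T' : S.Homology E →ₗ[ℤ] S.Homology F} (h' : S.IsInducedByIncl hEF T')
    (h : S.IsInducedByIncl hDE T) : S.IsInducedByIncl (hDE.trans hEF) (T' ∘ₗ T) := by
  intro k z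
  obtain ⟨hz, e⟩ := h k z
  -- The witness `hz` makes the image of `z` a cycle of `E`, to which `h'` applies.
  obtain ⟨hz', e'⟩ := h' k ⟨_, hz⟩
  have hi := incl_incl hDE hEF z.1
  -- The two-step and the direct inclusion of `z` are equal through `incl_incl`, so cycle membership
  -- is transported along `hi`, and the two classes are compared through their underlying chains.
  refine ⟨hi ▸ hz', ?_⟩
  rw [LinearMap.comp_apply, e, e']
  exact congrArg _ (Subtype.ext hi)

theorem isInducedByIncl_id (S : Tangle M) (D : Finset M) :
    S.IsInducedByIncl (Finset.Subset.refl D) LinearMap.id := by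
  intro k z
  have hi : incl (Finset.Subset.refl D) z.1 = z.1 := LinearMap.congr_fun (incl_refl D) z.1
  refine ⟨hi.symm ▸ z.2, ?_⟩
  exact congrArg (S.homologyClass D k) (Subtype.ext hi.symm)

end Homoclinic.Tangle

theorem mainTheorem4 {M : Type*} [TopologicalSpace M] [ChartedSpace Homoclinic.Plane M]
    [IsManifold 𝓘(ℝ, Homoclinic.Plane) ∞ M] (S : Homoclinic.Tangle M) :
    -- the inclusion gives rise to the (unique) map `H(𝓘ᴰᴱ)` in homology with `[z] ↦ [𝓘ᴰᴱ z]`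
    (∀ D ∈ S.completeSets, ∀ E ∈ S.completeSets, ∀ (hDE : D ⊆ E) (hc : S.ChainCompatible hDE),
      S.IsInducedByIncl hDE (Homoclinic.Tangle.homologyMap hc) ∧
      ∀ T : S.Homology D →ₗ[ℤ] S.Homology E,
        S.IsInducedByIncl hDE T → T = Homoclinic.Tangle.homologyMap hc) ∧
    -- functoriality
    (∀ D ∈ S.completeSets, ∀ E ∈ S.completeSets, ∀ F ∈ S.completeSets,
      ∀ (hDE : D ⊆ E) (hEF : E ⊆ F) (hcDE : S.ChainCompatible hDE)
        (hcEF : S.ChainCompatible hEF) (hcDF : S.ChainCompatible (hDE.trans hEF)),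
      Homoclinic.Tangle.homologyMap hcEF ∘ₗ Homoclinic.Tangle.homologyMap hcDE = Homoclinic.Tangle.homologyMap hcDF) ∧
    -- identity
    (∀ D ∈ S.completeSets, ∃ hc : S.ChainCompatible (Finset.Subset.refl D),
      Homoclinic.Tangle.homologyMap hc = LinearMap.id) := by
  open Homoclinic.Tangle in
  exact ⟨fun _ _ _ _ _ hc => ⟨isInducedByIncl_homologyMap hc,
      fun _ hT => hT.unique (isInducedByIncl_homologyMap hc)⟩,
    -- The composite and the direct map are both induced by the inclusion along `hDE.trans hEF`,
    -- hence equal.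
    fun _ _ _ _ _ _ _ _ hcDE hcEF hcDF =>
      ((isInducedByIncl_homologyMap hcEF).comp (isInducedByIncl_homologyMap hcDE)).unique
        (isInducedByIncl_homologyMap hcDF),
    fun D _ => ⟨chainCompatible_refl S D,
      (isInducedByIncl_homologyMap _).unique (isInducedByIncl_id S D)⟩⟩
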